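/- For strings $x$ and $y$ over a common alphabet, let $\Delta_{\mathrm{edit}}(x,y)$ denote the edit distance, i.e. the minimum number of single-character insertions, deletions and substitutions needed to transform $x$ into $y$, and, when $x$ and $y$ have equal length, let $\Delta_{\mathrm{Hamming}}(x,y)$ denote the number of positions in which they differ. A map $\varphi:\{0,1\}^n\to\{0,1\}^N$ is an isometric embedding of the Hamming metric into the edit metric if $\Delta_{\mathrm{edit}}(\varphi(x),\varphi(y))=\Delta_{\mathrm{Hamming}}(x,y)$ for all $x,y\in\{0,1\}^n$; its rate is $n/N$. **Theorem.** There exists a universal constant $C\ge 1$ (a positive integer, independent of $n$) such that for every positive integer $n$ there is an isometric embedding $\varphi_n:\{0,1\}^n\to\{0,1\}^{Cn}$ of the Hamming metric into the edit metric. In particular, these embeddings have constant rate $1/C$. -/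

import Mathlib

/-- An edit distance alignment between strings of lengths `n` and `m`: a set
`{(i₁, j₁), …, (iₖ, jₖ)}` of pairs of positions with `i₁ < ⋯ < iₖ` and `j₁ < ⋯ < jₖ`. -/
def IsAlignment {n m : ℕ} (A : Finset (Fin n × Fin m)) : Prop :=
  ∀ p ∈ A, ∀ q ∈ A, p.1 < q.1 ↔ p.2 < q.2

/-- The aligned pairs of positions carrying different symbols. -/
def substitutions {α : Type*} [DecidableEq α] {n m : ℕ} (x : Fin n → α) (y : Fin m → α)
    (A : Finset (Fin n × Fin m)) : Finset (Fin n × Fin m) :=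
  A.filter fun p => x p.1 ≠ y p.2

/-- The positions of the first string that are not aligned to anything. -/
def deletions {n m : ℕ} (A : Finset (Fin n × Fin m)) : Finset (Fin n) :=
  Finset.univ.filter fun i => ¬ ∃ j, (i, j) ∈ A

/-- The positions of the second string that are not aligned to anything. -/
def insertions {n m : ℕ} (A : Finset (Fin n × Fin m)) : Finset (Fin m) :=
  Finset.univ.filter fun j => ¬ ∃ i, (i, j) ∈ A

/-- The cost of an alignment: substitutions plus deletions plus insertions. -/
def alignmentCost {α : Type*} [DecidableEq α] {n m : ℕ} (x : Fin n → α) (y : Fin m → α)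
    (A : Finset (Fin n × Fin m)) : ℕ :=
  (substitutions x y A).card + (deletions A).card + (insertions A).card

/-- The edit distance: the least cost of an alignment (attained, see `editDist_isLeast`). -/
noncomputable def editDist {α : Type*} [DecidableEq α] {n m : ℕ}
    (x : Fin n → α) (y : Fin m → α) : ℕ :=
  sInf {c : ℕ | ∃ A : Finset (Fin n × Fin m), IsAlignment A ∧ alignmentCost x y A = c}

theorem editDist_isLeast {α : Type*} [DecidableEq α] {n m : ℕ}
    (x : Fin n → α) (y : Fin m → α) :
    IsLeast {c : ℕ | ∃ A : Finset (Fin n × Fin m), IsAlignment A ∧ alignmentCost x y A = c}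
      (editDist x y) :=
  ⟨Nat.sInf_mem ⟨_, ∅, by simp [IsAlignment], rfl⟩, fun _ hc => Nat.sInf_le hc⟩

/-- `φ` is an isometric embedding of the Hamming metric into the edit metric. -/
def IsIsometricEmbedding {α : Type*} [DecidableEq α] {n N : ℕ}
    (φ : (Fin n → α) → (Fin N → α)) : Prop :=
  ∀ x y : Fin n → α, editDist (φ x) (φ y) = hammingDist x y

/-! Write the bits of `x` at the multiples of 1200 of a fixed word `w`. The diagonal alignment gives
edit distance at most Hamming distance. For the converse, cut an arbitrary alignment at its diagonal
pairs, where each mismatch is paid for by a substitution (`hammingBetween_le_costBetween`). On a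
remaining interval of length `L`, a cheap alignment would match a factor of `w` almost entirely with
itself off the diagonal (`exists_isSelfMatching`). If no factor of `w` of length at least 1200
admits this, the cost exceeds the number of data positions in the interval; shorter nonempty
intervals hold at most one data position and cost at least 1.

Such a `w` exists by counting. A self-matching and the symbols at its deleted positions determine a
word, so there are at most `(4/3)^L` repetitive words (`ncard_repetitiveWords_le`). That is few
enough for the number of words avoiding them to grow by a factor of at least 3/2 per letter
(`nonempty_avoidingWords`). -/

/-! ### Counting words that avoid forbidden factors -/

/-- The words of length `n` none of whose factors lies in `B`. -/
def avoidingWords {α : Type*} (B : Set (List α)) (n : ℕ) : Set (List α) :=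
  {l | l.length = n ∧ ∀ u ∈ B, ¬ u <:+: l}

theorem finite_avoidingWords {α : Type*} [Finite α] (B : Set (List α)) (n : ℕ) :
    (avoidingWords B n).Finite :=
  (List.finite_length_eq α n).subset fun _ hl => hl.1

/-- Prepending a letter to a word that avoids `B` gives a word that avoids `B`, or a word with a
prefix in `B` followed by a word that avoids `B`. -/
theorem card_mul_ncard_avoidingWords_le {α : Type*} [Fintype α] (B : Set (List α)) (n : ℕ) :
    Fintype.card α * (avoidingWords B n).ncard ≤ (avoidingWords B (n + 1)).ncard +
      ∑ L ∈ Finset.range (n + 2),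
        {u ∈ B | u.length = L}.ncard * (avoidingWords B (n + 1 - L)).ncard := by
  have hfin : ∀ L, {u ∈ B | u.length = L}.Finite := fun L =>
    (List.finite_length_eq α L).subset fun _ hu => hu.2
  have hinj : Function.Injective fun p : α × List α => p.1 :: p.2 := by
    rintro ⟨a, l⟩ ⟨b, m⟩ h
    simpa using h
  have hsub : (fun p : α × List α => p.1 :: p.2) '' (Set.univ ×ˢ avoidingWords B n) ⊆
      avoidingWords B (n + 1) ∪ ⋃ L ∈ Finset.range (n + 2),
        (fun p : List α × List α => p.1 ++ p.2) ''
          ({u ∈ B | u.length = L} ×ˢ avoidingWords B (n + 1 - L)) := by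
    rintro _ ⟨⟨b, l⟩, ⟨-, hl, hav⟩, rfl⟩
    change l.length = n at hl
    by_cases h : ∀ u ∈ B, ¬ u <:+: b :: l
    · exact Or.inl ⟨by simp [hl], h⟩
    · push Not at h
      obtain ⟨u, hu, hinf⟩ := h
      rcases List.infix_cons_iff.1 hinf with ⟨t, ht⟩ | hinf
      · have hlen := congrArg List.length ht
        simp only [List.length_append, List.length_cons] at hlen
        refine Or.inr (Set.mem_biUnion (x := u.length) ?_
          ⟨(u, t), ⟨⟨hu, rfl⟩, by simp only; omega, fun v hv hvt => ?_⟩, ht⟩)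
        · simp only [Finset.coe_range, Set.mem_Iio]
          omega
        · cases u with
          | nil => exact hav [] hu (List.nil_infix)
          | cons c u =>
            simp only [List.cons_append, List.cons.injEq] at ht
            exact hav v hv (hvt.trans ⟨u, [], by simp [ht.2]⟩)
      · exact absurd hinf (hav u hu)
  have hfin' : ∀ L, ((fun p : List α × List α => p.1 ++ p.2) ''
      ({u ∈ B | u.length = L} ×ˢ avoidingWords B (n + 1 - L))).Finite := fun L =>
    ((hfin L).prod (finite_avoidingWords B _)).image _
  calc Fintype.card α * (avoidingWords B n).ncard
      = ((fun p : α × List α => p.1 :: p.2) '' (Set.univ ×ˢ avoidingWords B n)).ncard := by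
        rw [Set.ncard_image_of_injective _ hinj, Set.ncard_prod, Set.ncard_univ,
          Nat.card_eq_fintype_card]
    _ ≤ _ := Set.ncard_le_ncard hsub ((finite_avoidingWords B _).union
        (Set.Finite.biUnion (Finset.finite_toSet _) fun L _ => hfin' L))
    _ ≤ _ := Set.ncard_union_le _ _
    _ ≤ _ := by
        gcongr
        refine (Finset.set_ncard_biUnion_le _ _).trans (Finset.sum_le_sum fun L _ => ?_)
        rw [← Set.ncard_prod]
        exact Set.ncard_image_le ((hfin L).prod (finite_avoidingWords B _))

/-- If there are few words of each length in `B`, then there are words of every length that avoid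
`B`. -/
theorem nonempty_avoidingWords {α : Type*} [Fintype α] (B : Set (List α)) (β : ℝ) (hβ : 0 < β)
    (hnil : [] ∉ B)
    (hB : ∀ m, β * ∑ L ∈ Finset.range m, ({u ∈ B | u.length = L}.ncard : ℝ) * β⁻¹ ^ L ≤
      Fintype.card α - β) (n : ℕ) :
    (avoidingWords B n).Nonempty := by
  set g : ℕ → ℝ := fun n => (avoidingWords B n).ncard with hg
  -- Nonemptiness is strengthened to geometric growth so that the induction closes: growth at
  -- shorter lengths gives `g (n - k) ≤ β⁻¹ ^ k * g n`, which bounds the forbidden extensions by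
  -- `(card α - β) * g n`.
  have hstep : ∀ n, β * g n ≤ g (n + 1) := by
    intro n
    induction n using Nat.strong_induction_on with
    | _ n ih =>
      have hback : ∀ k ≤ n, g (n - k) ≤ β⁻¹ ^ k * g n := by
        intro k
        induction k with
        | zero => simp
        | succ k ihk =>
          intro hk
          have h1 := ih (n - (k + 1)) (by omega)
          rw [show n - (k + 1) + 1 = n - k by omega] at h1
          calc g (n - (k + 1)) = β⁻¹ * (β * g (n - (k + 1))) := by field_simp
            _ ≤ β⁻¹ * (β⁻¹ ^ k * g n) := by
              exact mul_le_mul_of_nonneg_left (h1.trans (ihk (by omega))) (inv_nonneg.2 hβ.le)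
            _ = _ := by ring
      have hcount : (Fintype.card α : ℝ) * g n ≤ g (n + 1) + ∑ L ∈ Finset.range (n + 2),
          ({u ∈ B | u.length = L}.ncard : ℝ) * g (n + 1 - L) := by
        simp only [hg]
        exact_mod_cast card_mul_ncard_avoidingWords_le B n
      have hsum : ∑ L ∈ Finset.range (n + 2),
          ({u ∈ B | u.length = L}.ncard : ℝ) * g (n + 1 - L) ≤
          (β * ∑ L ∈ Finset.range (n + 2), ({u ∈ B | u.length = L}.ncard : ℝ) * β⁻¹ ^ L)
            * g n := by
        rw [Finset.mul_sum, Finset.sum_mul]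
        refine Finset.sum_le_sum fun L hL => ?_
        cases L with
        -- The term `L = 0` would involve `g (n + 1)` itself, out of reach of the induction; it
        -- vanishes because `[] ∉ B`.
        | zero =>
          have : {u ∈ B | u.length = 0} = ∅ := by
            ext u
            simp only [List.length_eq_zero_iff, Set.mem_ofPred_eq, Set.mem_empty_iff_false,
              iff_false, not_and]
            rintro hu rfl
            exact hnil hu
          rw [this]
          simp
        | succ k =>
          have hk := hback k (by simp at hL; omega)
          rw [Nat.add_sub_add_right]
          calc _ ≤ ({u ∈ B | u.length = k + 1}.ncard : ℝ) * (β⁻¹ ^ k * g n) := by gcongr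
            _ = _ := by
              rw [pow_succ]
              field_simp
      have hgn : 0 ≤ g n := Nat.cast_nonneg _
      nlinarith [mul_le_mul_of_nonneg_right (hB (n + 2)) hgn]
  have hpos : ∀ n, 0 < g n := by
    intro n
    induction n with
    | zero =>
      have h0 : [] ∈ avoidingWords B 0 :=
        ⟨rfl, fun u hu h => hnil (List.eq_nil_of_infix_nil h ▸ hu)⟩
      exact Nat.cast_pos.2 ((Set.ncard_pos (finite_avoidingWords B 0)).2 ⟨_, h0⟩)
    | succ n ih => exact (mul_pos hβ ih).trans_le (hstep n)
  exact (Set.ncard_pos (finite_avoidingWords B n)).1 (Nat.cast_pos.1 (hpos n))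

/-! ### Alignments and self-matchings -/

/-- `M` pairs equal symbols of `f` at distinct positions. -/
def IsSelfMatching {α : Type*} {L : ℕ} (f : Fin L → α) (M : Finset (Fin L × Fin L)) : Prop :=
  IsAlignment M ∧ ∀ p ∈ M, p.1 ≠ p.2 ∧ f p.1 = f p.2

theorem IsAlignment.fst_inj {n m : ℕ} {A : Finset (Fin n × Fin m)} (hA : IsAlignment A)
    {i i' : Fin n} {j : Fin m} (h : (i, j) ∈ A) (h' : (i', j) ∈ A) : i = i' := by
  have h1 := hA _ h _ h'
  have h2 := hA _ h' _ h
  simp only [lt_irrefl, iff_false, not_lt] at h1 h2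
  exact le_antisymm h2 h1

theorem IsAlignment.snd_inj {n m : ℕ} {A : Finset (Fin n × Fin m)} (hA : IsAlignment A)
    {i : Fin n} {j j' : Fin m} (h : (i, j) ∈ A) (h' : (i, j') ∈ A) : j = j' := by
  have h1 := hA _ h _ h'
  have h2 := hA _ h' _ h
  simp only [lt_irrefl, false_iff, not_lt] at h1 h2
  exact le_antisymm h2 h1

theorem mem_deletions {n m : ℕ} {A : Finset (Fin n × Fin m)} {i : Fin n} :
    i ∈ deletions A ↔ ∀ j, (i, j) ∉ A := by simp [deletions]

theorem mem_insertions {n m : ℕ} {A : Finset (Fin n × Fin m)} {j : Fin m} :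
    j ∈ insertions A ↔ ∀ i, (i, j) ∉ A := by simp [insertions]

theorem IsAlignment.card_add_card_deletions {n m : ℕ} {A : Finset (Fin n × Fin m)}
    (hA : IsAlignment A) : A.card + (deletions A).card = n := by
  have h1 : A.card = (Finset.univ.filter fun i => ∃ j, (i, j) ∈ A).card := by
    refine Finset.card_bij (fun p _ => p.1) (fun p hp => ?_) (fun p hp q hq h => ?_)
      fun i hi => ?_
    · simpa using ⟨p.2, hp⟩
    · obtain ⟨i, j⟩ := p
      obtain ⟨i', j'⟩ := q
      obtain rfl : i = i' := h
      rw [hA.snd_inj hp hq]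
    · obtain ⟨j, hj⟩ := (Finset.mem_filter.1 hi).2
      exact ⟨(i, j), hj, rfl⟩
  rw [h1, deletions, Finset.card_filter_add_card_filter_not]
  simp

theorem IsAlignment.card_add_card_insertions {n m : ℕ} {A : Finset (Fin n × Fin m)}
    (hA : IsAlignment A) : A.card + (insertions A).card = m := by
  have h1 : A.card = (Finset.univ.filter fun j => ∃ i, (i, j) ∈ A).card := by
    refine Finset.card_bij (fun p _ => p.2) (fun p hp => ?_) (fun p hp q hq h => ?_)
      fun j hj => ?_
    · simpa using ⟨p.1, hp⟩
    · obtain ⟨i, j⟩ := p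
      obtain ⟨i', j'⟩ := q
      obtain rfl : j = j' := h
      rw [hA.fst_inj hp hq]
    · obtain ⟨i, hi⟩ := (Finset.mem_filter.1 hj).2
      exact ⟨(i, j), hi, rfl⟩
  rw [h1, insertions, Finset.card_filter_add_card_filter_not]
  simp

/-- In an alignment, the positions below a pair are matched among each other. -/
theorem IsAlignment.card_filter_lt {n m : ℕ} {A : Finset (Fin n × Fin m)}
    (hA : IsAlignment A) {i : Fin n} {j : Fin m} (h : (i, j) ∈ A) :
    ((deletions A)ᶜ.filter (· < i)).card = ((insertions A)ᶜ.filter (· < j)).card := by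
  trans (A.filter fun p => p.1 < i).card
  · symm
    refine Finset.card_bij (fun p _ => p.1) (fun p hp => ?_) (fun p hp q hq h => ?_)
      fun k hk => ?_
    · simp only [Finset.mem_filter, Finset.mem_compl, mem_deletions] at hp ⊢
      exact ⟨fun hn => hn _ hp.1, hp.2⟩
    · obtain ⟨i, j⟩ := p
      obtain ⟨i', j'⟩ := q
      obtain rfl : i = i' := h
      rw [hA.snd_inj (Finset.mem_filter.1 hp).1 (Finset.mem_filter.1 hq).1]
    · simp only [Finset.mem_filter, Finset.mem_compl, mem_deletions, not_forall, not_not] at hk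
      obtain ⟨⟨j, hj⟩, hk⟩ := hk
      exact ⟨(k, j), by simp [hj, hk], rfl⟩
  · refine Finset.card_bij (fun p _ => p.2) (fun p hp => ?_) (fun p hp q hq h => ?_)
      fun k hk => ?_
    · simp only [Finset.mem_filter, Finset.mem_compl, mem_insertions] at hp ⊢
      exact ⟨fun hn => hn _ hp.1, (hA _ hp.1 _ h).1 hp.2⟩
    · obtain ⟨i, j⟩ := p
      obtain ⟨i', j'⟩ := q
      obtain rfl : j = j' := h
      rw [hA.fst_inj (Finset.mem_filter.1 hp).1 (Finset.mem_filter.1 hq).1]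
    · simp only [Finset.mem_filter, Finset.mem_compl, mem_insertions, not_forall, not_not] at hk
      obtain ⟨⟨i', hi'⟩, hk⟩ := hk
      exact ⟨(i', k), by simpa [hi'] using (hA _ hi' _ h).2 hk, rfl⟩

/-- An alignment is determined by its unaligned positions. -/
theorem IsAlignment.eq_of_deletions_eq_of_insertions_eq {n m : ℕ} {A A' : Finset (Fin n × Fin m)}
    (hA : IsAlignment A) (hA' : IsAlignment A') (hd : deletions A = deletions A')
    (hi : insertions A = insertions A') : A = A' := by
  have key : ∀ {B B' : Finset (Fin n × Fin m)}, IsAlignment B → IsAlignment B' →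
      deletions B = deletions B' → insertions B = insertions B' → B ⊆ B' := by
    rintro B B' hB hB' hd hi ⟨i, j⟩ h
    have h1 : i ∉ deletions B' := by
      rw [← hd, mem_deletions]
      exact fun hn => hn j h
    rw [mem_deletions] at h1
    push Not at h1
    obtain ⟨j', h'⟩ := h1
    -- The partner of `i` is the aligned position with the same rank, and ranks depend only on the
    -- unaligned positions.
    have hcard := (hB.card_filter_lt h).symm.trans ((congrArg (fun D => (Dᶜ.filter (· < i)).card)
      hd).trans (hB'.card_filter_lt h'))
    rw [hi] at hcard
    have hlt : ∀ {a b : Fin m}, a ∈ (insertions B')ᶜ → a < b →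
        ((insertions B')ᶜ.filter (· < a)).card < ((insertions B')ᶜ.filter (· < b)).card := by
      intro a b ha hab
      refine Finset.card_lt_card (Finset.ssubset_iff_of_subset (fun c hc => ?_) |>.2
        ⟨a, by simpa [hab] using ha, by simp⟩)
      simp only [Finset.mem_filter] at hc ⊢
      exact ⟨hc.1, hc.2.trans hab⟩
    have hj : j ∈ (insertions B')ᶜ := by
      rw [← hi, Finset.mem_compl, mem_insertions]
      exact fun hn => hn i h
    have hj' : j' ∈ (insertions B')ᶜ := by
      rw [Finset.mem_compl, mem_insertions]
      exact fun hn => hn i h'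
    rcases lt_trichotomy j j' with hjj | rfl | hjj
    · exact absurd hcard (hlt hj hjj).ne
    · exact h'
    · exact absurd hcard (hlt hj' hjj).ne'
  exact (key hA hA' hd hi).antisymm (key hA' hA hd.symm hi.symm)

/-- A word is determined by a self-matching and the symbols at the deleted positions. -/
theorem IsSelfMatching.eq_of_eqOn {α : Type*} {L : ℕ} {f g : Fin L → α}
    {M : Finset (Fin L × Fin L)} (hf : IsSelfMatching f M) (hg : IsSelfMatching g M)
    (h : ∀ i ∈ deletions M, f i = g i) : f = g := by
  -- A position where `f` and `g` differ has a partner where they differ too. Monotonicity makes the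
  -- chain of partners continue in the direction of its first step, which is impossible in a finite
  -- order.
  have hnext : ∀ i, f i ≠ g i → ∃ j, (i, j) ∈ M ∧ i ≠ j ∧ f j ≠ g j := by
    intro i hi
    have : i ∉ deletions M := fun hd => hi (h i hd)
    rw [mem_deletions] at this
    push Not at this
    obtain ⟨j, hj⟩ := this
    refine ⟨j, hj, (hf.2 _ hj).1, ?_⟩
    rwa [← (hf.2 _ hj).2, ← (hg.2 _ hj).2]
  have hup : ∀ i j, (i, j) ∈ M → f i ≠ g i → ¬ i < j := by
    intro i
    induction i using WellFoundedGT.induction with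
    | _ i ih =>
      intro j hij hi hlt
      have hj : f j ≠ g j := by rwa [← (hf.2 _ hij).2, ← (hg.2 _ hij).2]
      obtain ⟨k, hk, -, -⟩ := hnext j hj
      exact ih j hlt k hk hj ((hf.1 _ hij _ hk).1 hlt)
  have hdown : ∀ i j, (i, j) ∈ M → f i ≠ g i → ¬ j < i := by
    intro i
    induction i using WellFoundedLT.induction with
    | _ i ih =>
      intro j hij hi hlt
      have hj : f j ≠ g j := by rwa [← (hf.2 _ hij).2, ← (hg.2 _ hij).2]
      obtain ⟨k, hk, -, -⟩ := hnext j hj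
      exact ih j hlt k hk hj ((hf.1 _ hk _ hij).1 hlt)
  by_contra hne
  obtain ⟨i, hi⟩ := Function.ne_iff.1 hne
  obtain ⟨j, hj, hij, -⟩ := hnext i hi
  rcases lt_or_gt_of_ne hij with hlt | hlt
  · exact hup i j hj hi hlt
  · exact hdown i j hj hi hlt

/-! ### Repetitive words are rare and can be avoided -/

/-- Binary words that match themselves off the diagonal up to a `1/200` fraction of their
positions. -/
def repetitiveWords (L : ℕ) : Set (Fin L → Bool) :=
  {f | ∃ M, IsSelfMatching f M ∧ 200 * (deletions M).card ≤ L}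

/-- Three small sets encode such a word: the deletions, the insertions (equally many, since both
sides have length `L`), and the deleted positions carrying `true`. -/
theorem ncard_repetitiveWords_le_card_pow (L : ℕ) :
    (repetitiveWords L).ncard ≤
      (Finset.univ.filter fun S : Finset (Fin L) => 200 * S.card ≤ L).card ^ 3 := by
  choose! M hM hcard using fun (f : Fin L → Bool) (hf : f ∈ repetitiveWords L) => hf
  have hle := Set.ncard_le_ncard_of_injOn (s := repetitiveWords L)
    (t := (((Finset.univ.filter fun S : Finset (Fin L) => 200 * S.card ≤ L) ×ˢ
      (Finset.univ.filter fun S : Finset (Fin L) => 200 * S.card ≤ L) ×ˢ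
      (Finset.univ.filter fun S : Finset (Fin L) => 200 * S.card ≤ L) : Finset _) : Set _))
    (fun f => (deletions (M f), insertions (M f), (deletions (M f)).filter (f · = true)))
    (fun f hf => ?_) (fun f hf g hg hfg => ?_)
  · rw [Set.ncard_coe_finset] at hle
    refine hle.trans_eq ?_
    rw [Finset.card_product, Finset.card_product]
    ring
  · have h1 := (hM f hf).1.card_add_card_deletions
    have h2 := (hM f hf).1.card_add_card_insertions
    have h3 := hcard f hf
    have h4 := Finset.card_filter_le (deletions (M f)) (f · = true)
    simp only [Finset.coe_product, Finset.coe_filter, Finset.mem_univ, true_and, Set.mem_prod,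
      Set.mem_ofPred_eq]
    exact ⟨h3, by omega, by omega⟩
  · simp only [Prod.mk.injEq] at hfg
    obtain ⟨hd, hi, hT⟩ := hfg
    have hMM := (hM f hf).1.eq_of_deletions_eq_of_insertions_eq (hM g hg).1 hd hi
    refine (hM f hf).eq_of_eqOn (hMM ▸ hM g hg) fun i hi => ?_
    have := Finset.ext_iff.1 hT i
    simp only [Finset.mem_filter, hi, hd ▸ hi, true_and] at this
    exact Bool.eq_iff_iff.2 this

/-- Giving each subset `S` the weight `(1/16)^|S|` makes the total `(17/16)^L`, while a small subset
weighs at least `(1/16)^(L/200)`. After cubing, the loss `16^3` per 200 letters is below a factor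
21/20 per letter, and `(17/16)^3 * (21/20) ≤ 4/3`. -/
theorem ncard_repetitiveWords_le (L : ℕ) :
    ((repetitiveWords L).ncard : ℝ) ≤ (4 / 3) ^ L := by
  set s := (Finset.univ.filter fun S : Finset (Fin L) => 200 * S.card ≤ L).card with hs
  have h1 : (s : ℝ) * (1 / 16) ^ (L / 200) ≤ (17 / 16) ^ L := by
    have := Fintype.sum_pow_mul_eq_add_pow (Fin L) (1 / 16 : ℝ) 1
    simp only [one_pow, mul_one, Fintype.card_fin] at this
    rw [show (17 / 16 : ℝ) = 1 / 16 + 1 by norm_num, ← this, hs, ← nsmul_eq_mul]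
    refine (Finset.card_nsmul_le_sum _ _ _ fun S hS => ?_).trans
      (Finset.sum_le_univ_sum_of_nonneg fun S => by positivity)
    refine pow_le_pow_of_le_one (by norm_num) (by norm_num) ?_
    have := (Finset.mem_filter.1 hS).2
    omega
  have h2 : ((16 : ℝ) ^ 3) ^ (L / 200) ≤ (21 / 20) ^ L :=
    calc ((16 : ℝ) ^ 3) ^ (L / 200) ≤ ((21 / 20) ^ 200) ^ (L / 200) := by
          gcongr
          norm_num
      _ = (21 / 20) ^ (200 * (L / 200)) := (pow_mul _ _ _).symm
      _ ≤ _ := pow_le_pow_right₀ (by norm_num) (Nat.mul_div_le _ _)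
  have h3 : (s : ℝ) ≤ (17 / 16) ^ L * 16 ^ (L / 200) := by
    calc (s : ℝ) = s * (1 / 16) ^ (L / 200) * 16 ^ (L / 200) := by
          rw [mul_assoc, ← mul_pow]
          norm_num
      _ ≤ _ := by gcongr
  calc ((repetitiveWords L).ncard : ℝ) ≤ (s : ℝ) ^ 3 := by
        exact_mod_cast ncard_repetitiveWords_le_card_pow L
    _ ≤ ((17 / 16) ^ L * 16 ^ (L / 200)) ^ 3 := by gcongr
    _ = ((17 / 16) ^ 3) ^ L * (16 ^ 3) ^ (L / 200) := by
        rw [mul_pow, pow_right_comm, pow_right_comm (16 : ℝ)]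
    _ ≤ ((17 / 16) ^ 3) ^ L * (21 / 20) ^ L := by gcongr
    _ = ((17 / 16) ^ 3 * (21 / 20)) ^ L := (mul_pow _ _ _).symm
    _ ≤ _ := by gcongr; norm_num

/-- There are binary words of every length without repetitive factors of length at least `1200`. -/
theorem exists_word_without_repetitive_factors (N : ℕ) :
    ∃ w : ℕ → Bool, ∀ a L, 1200 ≤ L → a + L ≤ N →
      (fun i : Fin L => w (a + i)) ∉ repetitiveWords L := by
  set B : Set (List Bool) := {u | ∃ L, 1200 ≤ L ∧ ∃ f ∈ repetitiveWords L, u = List.ofFn f}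
    with hBdef
  have hshort : ∀ L < 1200, {u ∈ B | u.length = L} = ∅ := by
    intro L hL
    ext u
    simp only [Set.mem_ofPred_eq, Set.mem_empty_iff_false, iff_false, not_and, hBdef]
    rintro ⟨K, hK, f, -, rfl⟩
    rw [List.length_ofFn]
    omega
  have hcard : ∀ L, ({u ∈ B | u.length = L}.ncard : ℝ) ≤ (4 / 3) ^ L := by
    intro L
    refine le_trans ?_ (ncard_repetitiveWords_le L)
    have hsub : {u ∈ B | u.length = L} ⊆ List.ofFn '' repetitiveWords L := by
      rintro _ ⟨⟨K, -, f, hf, rfl⟩, hlen⟩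
      rw [List.length_ofFn] at hlen
      subst hlen
      exact ⟨f, hf, rfl⟩
    exact_mod_cast (Set.ncard_le_ncard hsub (Set.toFinite _)).trans
      (Set.ncard_image_le (Set.toFinite _))
  have hnil : [] ∉ B := by
    rintro ⟨K, hK, f, -, h⟩
    have := congrArg List.length h
    rw [List.length_nil, List.length_ofFn] at this
    omega
  obtain ⟨c, hc0, hc, hterm⟩ : ∃ c : ℝ, 0 ≤ c ∧ c ≤ 1 / 51 ∧
      ∀ L, ({u ∈ B | u.length = L}.ncard : ℝ) * (3 / 2 : ℝ)⁻¹ ^ L ≤ c * (16 / 17) ^ L := by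
    -- The ratio `(4/3)/(3/2) = 8/9` is split as `(17/18) * (16/17)`: the first factor is tiny once
    -- `L ≥ 1200`, the second keeps the series summable with sum 17. The bound 1/51 is what `(3/2) *
    -- c * 17 ≤ 2 - 3/2` requires.
    refine ⟨(17 / 18) ^ 1200, by positivity,
      (pow_le_pow_of_le_one (by norm_num) (by norm_num) (show 72 ≤ 1200 by norm_num)).trans
        (by norm_num), fun L => ?_⟩
    rcases lt_or_ge L 1200 with hL | hL
    · rw [hshort L hL]
      simp only [Set.ncard_empty, Nat.cast_zero, zero_mul]
      positivity
    · calc _ ≤ (4 / 3 : ℝ) ^ L * (3 / 2 : ℝ)⁻¹ ^ L := by gcongr; exact hcard L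
        _ = (17 / 18) ^ L * (16 / 17) ^ L := by rw [← mul_pow, ← mul_pow]; norm_num
        _ ≤ _ := mul_le_mul_of_nonneg_right
          (pow_le_pow_of_le_one (by norm_num) (by norm_num) hL) (by positivity)
  have hsum : ∀ m, (3 / 2 : ℝ) * ∑ L ∈ Finset.range m,
      ({u ∈ B | u.length = L}.ncard : ℝ) * (3 / 2 : ℝ)⁻¹ ^ L ≤ Fintype.card Bool - 3 / 2 := by
    intro m
    have hgeom : ∑ L ∈ Finset.range m, (16 / 17 : ℝ) ^ L ≤ 17 := by
      have h : (0 : ℝ) ≤ (16 / 17) ^ m := by positivity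
      rw [geom_sum_eq (by norm_num), div_le_iff_of_neg (by norm_num)]
      linarith
    calc _ ≤ (3 / 2 : ℝ) * ∑ L ∈ Finset.range m, c * (16 / 17) ^ L := by
          exact mul_le_mul_of_nonneg_left (Finset.sum_le_sum fun L _ => hterm L) (by norm_num)
      _ = (3 / 2 : ℝ) * (c * ∑ L ∈ Finset.range m, (16 / 17) ^ L) := by
          rw [← Finset.mul_sum]
      _ ≤ (3 / 2 : ℝ) * (1 / 51 * 17) := by gcongr
      _ ≤ _ := by rw [Fintype.card_bool]; norm_num
  obtain ⟨l, hl, hav⟩ := nonempty_avoidingWords B (3 / 2) (by norm_num) hnil hsum N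
  -- The default `false` is never read in a factor with `a + L ≤ N`.
  refine ⟨fun i => l.getD i false, fun a L hL haL hrep => hav _ ⟨L, hL, _, hrep, rfl⟩ ?_⟩
  have : List.ofFn (fun i : Fin L => l.getD (a + i) false) = (l.drop a).take L := by
    apply List.ext_getElem
    · rw [List.length_ofFn, List.length_take, List.length_drop]
      omega
    · intro i h1 h2
      rw [List.length_ofFn] at h1
      simp [List.getElem?_eq_getElem (show a + i < l.length by omega)]
  rw [this]
  exact (List.take_prefix _ _).isInfix.trans (List.drop_suffix _ _).isInfix

/-! ### Localisation to intervals between diagonal pairs -/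

/-- The part of the Hamming distance that comes from the positions in `[a, b)`. -/
def hammingBetween {α : Type*} [DecidableEq α] {N : ℕ} (x y : Fin N → α) (a b : ℕ) : ℕ :=
  ((Finset.univ.filter fun t => x t ≠ y t).filter fun t : Fin N => a ≤ (t : ℕ) ∧ (t : ℕ) < b).card

/-- The part of the cost of an alignment that comes from the positions in `[a, b)`. -/
def costBetween {α : Type*} [DecidableEq α] {N : ℕ} (x y : Fin N → α)
    (A : Finset (Fin N × Fin N)) (a b : ℕ) : ℕ :=
  ((substitutions x y A).filter fun p => a ≤ p.1 ∧ p.1 < b).card +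
    ((deletions A).filter fun t : Fin N => a ≤ (t : ℕ) ∧ (t : ℕ) < b).card +
    ((insertions A).filter fun t : Fin N => a ≤ (t : ℕ) ∧ (t : ℕ) < b).card

/-- The alignment matches no position in `[a, b)` to a position outside `[a, b)`. -/
def PreservesInterval {N : ℕ} (A : Finset (Fin N × Fin N)) (a b : ℕ) : Prop :=
  ∀ p ∈ A, (a ≤ (p.1 : ℕ) ∧ (p.1 : ℕ) < b) ↔ (a ≤ (p.2 : ℕ) ∧ (p.2 : ℕ) < b)

theorem Finset.card_filter_interval_add {ι : Type*} (s : Finset ι) (v : ι → ℕ) {a b c : ℕ}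
    (hab : a ≤ b) (hbc : b ≤ c) :
    (s.filter fun i => a ≤ v i ∧ v i < c).card =
      (s.filter fun i => a ≤ v i ∧ v i < b).card + (s.filter fun i => b ≤ v i ∧ v i < c).card := by
  classical
  rw [← Finset.card_union_of_disjoint]
  · congr 1
    ext i
    simp only [Finset.mem_filter, Finset.mem_union, ← and_or_left]
    refine and_congr_right fun _ => ?_
    omega
  · rw [Finset.disjoint_filter]
    intro i _ h1 h2
    omega

theorem hammingBetween_add {α : Type*} [DecidableEq α] {N : ℕ} (x y : Fin N → α) {a b c : ℕ}
    (hab : a ≤ b) (hbc : b ≤ c) :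
    hammingBetween x y a c = hammingBetween x y a b + hammingBetween x y b c := by
  exact Finset.card_filter_interval_add _ (fun t : Fin N => (t : ℕ)) hab hbc

theorem costBetween_add {α : Type*} [DecidableEq α] {N : ℕ} (x y : Fin N → α)
    (A : Finset (Fin N × Fin N)) {a b c : ℕ} (hab : a ≤ b) (hbc : b ≤ c) :
    costBetween x y A a c = costBetween x y A a b + costBetween x y A b c := by
  have h1 := Finset.card_filter_interval_add (substitutions x y A)
    (fun p : Fin N × Fin N => (p.1 : ℕ)) hab hbc
  have h2 := Finset.card_filter_interval_add (deletions A) (fun t : Fin N => (t : ℕ)) hab hbc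
  have h3 := Finset.card_filter_interval_add (insertions A) (fun t : Fin N => (t : ℕ)) hab hbc
  simp only [costBetween]
  omega

theorem hammingBetween_le_costBetween_of_diagonal {α : Type*} [DecidableEq α] {N : ℕ}
    (x y : Fin N → α) {A : Finset (Fin N × Fin N)} {t : Fin N} (ht : (t, t) ∈ A) :
    hammingBetween x y t (t + 1) ≤ costBetween x y A t (t + 1) := by
  refine le_trans ?_ ((Nat.le_add_right _ _).trans (Nat.le_add_right _ _))
  refine Finset.card_le_card_of_injOn (fun s => (s, s)) (fun s hs => ?_) fun s _ s' _ h => ?_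
  · simp only [Finset.coe_filter, Finset.mem_filter, Finset.mem_univ, true_and,
      Set.mem_ofPred_eq] at hs
    obtain rfl : s = t := Fin.ext (by omega)
    simp only [substitutions, Finset.filter_filter, Finset.coe_filter, Set.mem_ofPred_eq]
    exact ⟨ht, hs.1, hs.2⟩
  · exact (Prod.mk.inj h).1

/-- It suffices to compare the Hamming distance and the cost of an alignment on the intervals
without diagonal pairs. -/
theorem hammingBetween_le_costBetween {α : Type*} [DecidableEq α] {N : ℕ} (x y : Fin N → α)
    {A : Finset (Fin N × Fin N)} (hA : IsAlignment A)
    (hoff : ∀ a L, a + L ≤ N → PreservesInterval A a (a + L) →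
      (∀ t : Fin N, a ≤ t → t < a + L → (t, t) ∉ A) →
      hammingBetween x y a (a + L) ≤ costBetween x y A a (a + L)) (L : ℕ) :
    ∀ a, a + L ≤ N → PreservesInterval A a (a + L) →
      hammingBetween x y a (a + L) ≤ costBetween x y A a (a + L) := by
  induction L using Nat.strong_induction_on with
  | _ L ih =>
    intro a haL hpres
    by_cases h : ∀ t : Fin N, a ≤ t → t < a + L → (t, t) ∉ A
    · exact hoff a L haL hpres h
    · push Not at h
      obtain ⟨t, hat, htL, ht⟩ := h
      -- No pair crosses the diagonal pair `(t, t)`, so the pieces of the interval before and after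
      -- `t` are again preserved.
      have hlt : ∀ p ∈ A, (p.1 : ℕ) < t ↔ (p.2 : ℕ) < t := fun p hp => hA p hp _ ht
      have hgt : ∀ p ∈ A, (t : ℕ) < p.1 ↔ (t : ℕ) < p.2 := fun p hp => hA _ ht p hp
      have h1 := ih (t - a) (by omega) a (by omega) fun p hp => by
        have := hlt p hp
        have := hpres p hp
        omega
      have h2 := ih (a + L - (t + 1)) (by omega) (t + 1) (by omega) fun p hp => by
        have := hgt p hp
        have := hpres p hp
        omega
      rw [Nat.add_sub_cancel' hat] at h1
      rw [Nat.add_sub_cancel' (by omega : (t : ℕ) + 1 ≤ a + L)] at h2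
      have h3 := hammingBetween_le_costBetween_of_diagonal x y ht
      rw [hammingBetween_add x y hat htL.le, costBetween_add x y A hat htL.le,
        hammingBetween_add x y (Nat.le_add_right t 1) htL, costBetween_add x y A (Nat.le_add_right t 1) htL]
      omega

/-- The bound `⌈L / k⌉` on the number of data positions, cleared of its division for use in linear
arithmetic. -/
theorem card_filter_dvd_mul_le (N a L k : ℕ) (hk : 0 < k) :
    (Finset.univ.filter fun t : Fin N => k ∣ (t : ℕ) ∧ a ≤ t ∧ t < a + L).card * k ≤
      L + (k - 1) := by
  have h : (Finset.univ.filter fun t : Fin N => k ∣ (t : ℕ) ∧ a ≤ t ∧ t < a + L).card ≤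
      (Finset.Ico ((a + (k - 1)) / k) ((a + L + (k - 1)) / k)).card := by
    refine Finset.card_le_card_of_injOn (fun t => (t : ℕ) / k) (fun t ht => ?_)
      fun t ht s hs h => ?_
    · simp only [Finset.coe_filter, Finset.mem_univ, true_and, Set.mem_ofPred_eq] at ht
      obtain ⟨⟨q, hq⟩, h1, h2⟩ := ht
      simp only [Finset.coe_Ico, Set.mem_Ico, hq, Nat.mul_div_cancel_left q hk]
      constructor
      · rw [← Nat.lt_succ_iff, Nat.div_lt_iff_lt_mul hk, Nat.succ_mul, Nat.mul_comm q k]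
        omega
      · rw [Nat.lt_iff_add_one_le, Nat.le_div_iff_mul_le hk, Nat.succ_mul, Nat.mul_comm q k]
        omega
    · simp only [Finset.coe_filter, Finset.mem_univ, true_and, Set.mem_ofPred_eq] at ht hs
      exact Fin.ext (by rw [← Nat.div_mul_cancel ht.1, ← Nat.div_mul_cancel hs.1]; congr 1)
  rw [Nat.card_Ico] at h
  have h1 := Nat.div_mul_le_self (a + L + (k - 1)) k
  have h2 := Nat.lt_div_mul_add (a := a + (k - 1)) hk
  have h3 := Nat.mul_le_mul_right k h
  rw [Nat.sub_mul] at h3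
  omega

/-- An alignment that preserves a nonempty interval but contains none of its diagonal pairs leaves
a position of the interval unaligned. -/
theorem one_le_costBetween {α : Type*} [DecidableEq α] {N : ℕ} (x y : Fin N → α)
    {A : Finset (Fin N × Fin N)} (hA : IsAlignment A) {a b : ℕ} (hab : a < b) (hb : b ≤ N)
    (hpres : PreservesInterval A a b) (hoff : ∀ t : Fin N, a ≤ t → t < b → (t, t) ∉ A) :
    1 ≤ costBetween x y A a b := by
  by_contra hlt
  obtain ⟨⟨-, hd⟩, hi⟩ : (_ = 0 ∧ _ = 0) ∧ _ = 0 := by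
    simpa only [costBetween, not_le, Nat.lt_one_iff, Nat.add_eq_zero_iff] using hlt
  rw [Finset.card_eq_zero, Finset.filter_eq_empty_iff] at hd hi
  -- If the first position were aligned on both sides, both partners would lie strictly to its
  -- right, and the two pairs would cross.
  set t : Fin N := ⟨a, hab.trans_le hb⟩ with ht
  have hd : t ∉ deletions A := fun h => hd h ⟨le_rfl, hab⟩
  have hi : t ∉ insertions A := fun h => hi h ⟨le_rfl, hab⟩
  rw [mem_deletions] at hd
  rw [mem_insertions] at hi
  push Not at hd hi
  obtain ⟨j, hj⟩ := hd
  obtain ⟨i, hi⟩ := hi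
  have hne := hoff t le_rfl hab
  have h1 : t < j := lt_of_le_of_ne ((hpres _ hj).1 ⟨le_rfl, hab⟩).1
    (by rintro rfl; exact hne hj)
  have h2 : t < i := lt_of_le_of_ne ((hpres _ hi).2 ⟨le_rfl, hab⟩).1
    (by rintro h; exact hne (h ▸ hi))
  exact lt_asymm h1 ((hA _ hj _ hi).1 h2)

/-- An alignment of two words that agree with `w` outside the multiples of `k` induces a
self-matching of each factor of `w` that it preserves without using diagonal pairs. -/
theorem exists_isSelfMatching {α : Type*} [DecidableEq α] {N : ℕ} {x y : Fin N → α} {w : ℕ → α}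
    {k : ℕ} (hx : ∀ t : Fin N, ¬ k ∣ (t : ℕ) → x t = w t)
    (hy : ∀ t : Fin N, ¬ k ∣ (t : ℕ) → y t = w t)
    {A : Finset (Fin N × Fin N)} (hA : IsAlignment A) {a L : ℕ} (haL : a + L ≤ N)
    (hpres : PreservesInterval A a (a + L))
    (hoff : ∀ t : Fin N, a ≤ t → t < a + L → (t, t) ∉ A) :
    ∃ M, IsSelfMatching (fun i : Fin L => w (a + i)) M ∧
      (deletions M).card ≤ costBetween x y A a (a + L) +
        2 * (Finset.univ.filter fun t : Fin N => k ∣ (t : ℕ) ∧ a ≤ t ∧ t < a + L).card := by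
  classical
  set e : Fin L → Fin N := fun i => ⟨a + i, by omega⟩ with he
  have heinj : Function.Injective e := fun i j h => by
    have := congrArg Fin.val h
    simp only [he] at this
    exact Fin.ext (by omega)
  have helt : ∀ i j, e i < e j ↔ i < j := fun i j =>
    Fin.lt_def.trans (Nat.add_lt_add_iff_left.trans Fin.lt_def.symm)
  set M : Finset (Fin L × Fin L) :=
    Finset.univ.filter fun p => (e p.1, e p.2) ∈ A ∧ w (a + p.1) = w (a + p.2) with hM
  set S := Finset.univ.filter fun t : Fin N => k ∣ (t : ℕ) ∧ a ≤ t ∧ t < a + L with hS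
  refine ⟨M, ⟨fun p hp q hq => ?_, fun p hp => ?_⟩, ?_⟩
  · simp only [hM, Finset.mem_filter, Finset.mem_univ, true_and] at hp hq
    rw [← helt, ← helt]
    exact hA _ hp.1 _ hq.1
  · simp only [hM, Finset.mem_filter, Finset.mem_univ, true_and] at hp
    refine ⟨fun h => hoff (e p.1) (Nat.le_add_right _ _) ?_ ?_, hp.2⟩
    · simp [he]
    · simpa [h] using hp.1
  -- A position is lost in `M` only if `A` deletes it, `A` substitutes it, it is a multiple of `k`,
  -- or its partner is one. The last two cases account for the factor 2.
  · have hsub : (deletions M).image e ⊆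
        ((deletions A).filter fun t : Fin N => a ≤ (t : ℕ) ∧ (t : ℕ) < a + L) ∪
        ((substitutions x y A).filter fun p => a ≤ p.1 ∧ p.1 < a + L).image Prod.fst ∪
        (S ∪ (A.filter fun p => p.2 ∈ S).image Prod.fst) := by
      intro t ht
      obtain ⟨i, hi, rfl⟩ := Finset.mem_image.1 ht
      have hint : a ≤ (e i : ℕ) ∧ (e i : ℕ) < a + L := ⟨Nat.le_add_right _ _, by simp [he]⟩
      rw [mem_deletions] at hi
      by_cases hd : e i ∈ deletions A
      · exact Finset.mem_union_left _ (Finset.mem_union_left _ (Finset.mem_filter.2 ⟨hd, hint⟩))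
      · rw [mem_deletions] at hd
        push Not at hd
        obtain ⟨s, hs⟩ := hd
        have hsint := (hpres _ hs).1 hint
        by_cases h1 : k ∣ (e i : ℕ)
        · exact Finset.mem_union_right _ (Finset.mem_union_left _ (by simp [hS, h1, hint]))
        by_cases h2 : k ∣ (s : ℕ)
        · exact Finset.mem_union_right _ (Finset.mem_union_right _
            (Finset.mem_image.2 ⟨(e i, s), by simp [hS, hs, h2, hsint], rfl⟩))
        refine Finset.mem_union_left _ (Finset.mem_union_right _
          (Finset.mem_image.2 ⟨(e i, s), ?_, rfl⟩))
        simp only [substitutions, Finset.mem_filter]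
        refine ⟨⟨hs, fun heq => ?_⟩, hint⟩
        rw [hx _ h1, hy _ h2] at heq
        obtain ⟨j, rfl⟩ : ∃ j, e j = s :=
          ⟨⟨s - a, by simp only at hsint; omega⟩, Fin.ext (Nat.add_sub_cancel' hsint.1)⟩
        exact hi j (Finset.mem_filter.2 ⟨Finset.mem_univ _, hs, heq⟩)
    have h1 : (A.filter fun p => p.2 ∈ S).card ≤ S.card := by
      refine Finset.card_le_card_of_injOn Prod.snd (fun p hp => (Finset.mem_filter.1 hp).2)
        fun p hp q hq h => ?_
      obtain ⟨i, j⟩ := p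
      obtain ⟨i', j'⟩ := q
      obtain rfl : j = j' := h
      rw [hA.fst_inj (Finset.mem_filter.1 hp).1 (Finset.mem_filter.1 hq).1]
    have h2 := Finset.card_le_card hsub
    rw [Finset.card_image_of_injective _ heinj] at h2
    have h3 := (h2.trans (Finset.card_union_le _ _)).trans
      (Nat.add_le_add (Finset.card_union_le _ _) (Finset.card_union_le _ _))
    have h4 := Finset.card_image_le (s := A.filter fun p => p.2 ∈ S) (f := Prod.fst)
    have h5 := Finset.card_image_le (f := Prod.fst)
      (s := (substitutions x y A).filter fun p => a ≤ p.1 ∧ p.1 < a + L)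
    simp only [costBetween]
    omega

/-- Words that agree outside the multiples of `1200` with a word without long repetitive factors
are at edit distance at least their Hamming distance. -/
theorem hammingDist_le_alignmentCost {N : ℕ} {x y : Fin N → Bool} {w : ℕ → Bool}
    (hw : ∀ a L, 1200 ≤ L → a + L ≤ N → (fun i : Fin L => w (a + i)) ∉ repetitiveWords L)
    (hx : ∀ t : Fin N, ¬ 1200 ∣ (t : ℕ) → x t = w t)
    (hy : ∀ t : Fin N, ¬ 1200 ∣ (t : ℕ) → y t = w t)
    {A : Finset (Fin N × Fin N)} (hA : IsAlignment A) :
    hammingDist x y ≤ alignmentCost x y A := by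
  have h := hammingBetween_le_costBetween x y hA (fun a L haL hpres hoff => ?_) N 0 (by omega)
    (fun p _ => by omega)
  · simpa [hammingBetween, costBetween, hammingDist, alignmentCost] using h
  · have hstar := card_filter_dvd_mul_le N a L 1200 (by norm_num)
    have hle : hammingBetween x y a (a + L) ≤
        (Finset.univ.filter fun t : Fin N => 1200 ∣ (t : ℕ) ∧ a ≤ t ∧ t < a + L).card := by
      refine Finset.card_le_card fun t ht => ?_
      simp only [Finset.mem_filter, Finset.mem_univ, true_and] at ht ⊢
      refine ⟨by_contra fun hn => ht.1 ?_, ht.2⟩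
      rw [hx t hn, hy t hn]
    rcases lt_or_ge L 1200 with hL | hL
    · rcases Nat.eq_zero_or_pos L with rfl | hpos
      · omega
      · have := one_le_costBetween x y hA (show a < a + L by omega) haL hpres hoff
        omega
    -- With `s` data positions, `L < 200 * (cost + 2 * s)`. Since `1200 * s ≤ L + 1199 < 2 * L`,
    -- also `600 * s < L`, whence `s < cost`; this is why the spacing is 6 times 200.
    · obtain ⟨M, hM, hcard⟩ := exists_isSelfMatching hx hy hA haL hpres hoff
      have : ¬ 200 * (deletions M).card ≤ L := fun h => hw a L hL haL ⟨M, hM, h⟩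
      omega

/-! ### The upper bound and the embedding -/

theorem editDist_le_hammingDist {α : Type*} [DecidableEq α] {N : ℕ} (x y : Fin N → α) :
    editDist x y ≤ hammingDist x y := by
  set A : Finset (Fin N × Fin N) := Finset.univ.image fun t => (t, t) with hA
  have hmem : ∀ t, (t, t) ∈ A := fun t => Finset.mem_image_of_mem _ (Finset.mem_univ t)
  have hd : deletions A = ∅ := Finset.eq_empty_of_forall_notMem fun t ht =>
    mem_deletions.1 ht t (hmem t)
  have hi : insertions A = ∅ := Finset.eq_empty_of_forall_notMem fun t ht =>
    mem_insertions.1 ht t (hmem t)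
  refine ((editDist_isLeast x y).2 ⟨A, fun p hp q hq => ?_, rfl⟩).trans ?_
  · obtain ⟨t, -, rfl⟩ := Finset.mem_image.1 hp
    obtain ⟨s, -, rfl⟩ := Finset.mem_image.1 hq
    rfl
  · rw [alignmentCost, hd, hi, Finset.card_empty, add_zero, add_zero, hammingDist]
    refine Finset.card_le_card_of_injOn Prod.fst (fun p hp => ?_) fun p hp q hq h => ?_
    · obtain ⟨hp, hne⟩ := Finset.mem_filter.1 hp
      obtain ⟨t, -, rfl⟩ := Finset.mem_image.1 hp
      simpa using hne
    · obtain ⟨t, -, rfl⟩ := Finset.mem_image.1 (Finset.mem_filter.1 hp).1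
      obtain ⟨s, -, rfl⟩ := Finset.mem_image.1 (Finset.mem_filter.1 hq).1
      obtain rfl : t = s := h
      rfl

/-- Writing `x` into the multiples of `k` of the word `w`. -/
def fillMultiples {α : Type*} (k n : ℕ) (w : ℕ → α) (x : Fin n → α) (t : Fin (k * n)) : α :=
  if k ∣ (t : ℕ) then x ⟨t / k, Nat.div_lt_of_lt_mul t.2⟩ else w t

theorem hammingDist_fillMultiples {α : Type*} [DecidableEq α] {k : ℕ} (hk : 0 < k) (n : ℕ)
    (w : ℕ → α) (x y : Fin n → α) :
    hammingDist (fillMultiples k n w x) (fillMultiples k n w y) = hammingDist x y := by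
  symm
  refine Finset.card_bij (fun i _ => ⟨k * i, Nat.mul_lt_mul_of_pos_left i.2 hk⟩)
    (fun i hi => ?_) (fun i _ j _ h => ?_) fun t ht => ?_
  · rw [Finset.mem_filter] at hi ⊢
    refine ⟨Finset.mem_univ _, ?_⟩
    rw [fillMultiples, fillMultiples, if_pos (Nat.dvd_mul_right k i),
      if_pos (Nat.dvd_mul_right k i)]
    simpa [hk] using hi.2
  · exact Fin.ext (Nat.eq_of_mul_eq_mul_left hk (congrArg Fin.val h))
  · have ht := (Finset.mem_filter.1 ht).2
    by_cases hdvd : k ∣ (t : ℕ)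
    · rw [fillMultiples, fillMultiples, if_pos hdvd, if_pos hdvd] at ht
      exact ⟨⟨t / k, _⟩, Finset.mem_filter.2 ⟨Finset.mem_univ _, ht⟩,
        Fin.ext (Nat.mul_div_cancel' hdvd)⟩
    · rw [fillMultiples, fillMultiples, if_neg hdvd, if_neg hdvd] at ht
      exact absurd rfl ht

theorem mainTheorem2 :
    ∃ C : ℕ, 1 ≤ C ∧ ∀ n : ℕ, 1 ≤ n →
      ∃ φ : (Fin n → Bool) → (Fin (C * n) → Bool), IsIsometricEmbedding φ := by
  refine ⟨1200, by norm_num, fun n _ => ?_⟩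
  obtain ⟨w, hw⟩ := exists_word_without_repetitive_factors (1200 * n)
  have hfill : ∀ (x : Fin n → Bool) (t : Fin (1200 * n)), ¬ 1200 ∣ (t : ℕ) →
      fillMultiples 1200 n w x t = w t := fun x t ht => if_neg ht
  refine ⟨fillMultiples 1200 n w, fun x y => ?_⟩
  rw [← hammingDist_fillMultiples (k := 1200) (by norm_num) n w x y]
  refine (editDist_le_hammingDist _ _).antisymm ?_
  obtain ⟨A, hA, hcost⟩ := (editDist_isLeast (fillMultiples 1200 n w x)
    (fillMultiples 1200 n w y)).1
  rw [← hcost]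
  exact hammingDist_le_alignmentCost hw (hfill x) (hfill y) hA
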